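/- Let $n\ge 1$, let $\Omega\subset\mathbb R^n$ be a bounded open set, let $\epsilon\in(0,\infty]$ and $T>0$. Put $$\alpha(x,y)=\frac{y-x}{|y-x|^{n/2+\beta(x)+1}}\,1_{\{|y-x|\le\epsilon\}},\qquad \Omega_{\mathcal I}=\{y\in\mathbb R^n\setminus\Omega:\ \alpha(x,y)\ne0\text{ for some }x\in\Omega\},\qquad \tilde\Omega=\Omega\cup\Omega_{\mathcal I},$$ where $\beta$ is a real function, continuous on $\tilde\Omega$, with $0<\beta_*\le\beta(x)\le\beta^*<1$ for $x\in\tilde\Omega$ and constants $\beta_*,\beta^*$. Let $a(t,x,y)=(a_{ij}(t,x,y))_{1\le i,j\le n}$ be symmetric, with $a_{ij}\in C^1([0,T]\times\mathbb R^n\times\mathbb R^n)$, and suppose that there are constants $a_*>0$ and $a^*$ with $$a_*|\xi|^2\le\sum_{i,j}a_{ij}(t,x,y)\xi_i\xi_j\le a^*|\xi|^2,\qquad \sum_{i,j}\partial_ta_{ij}(t,x,y)\xi_i\xi_j\le a^*|\xi|^2$$ for all $\xi\in\mathbb R^n$, $t\in[0,T]$ and $x,y\in\tilde\Omega$ with $|y-x|\le\epsilon$.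 For $u\in L^2(\tilde\Omega)$ let $\mathcal D^*(u)(x,y)=-(u(y)-u(x))\alpha(x,y)$ and, for $t\in[0,T]$, $$|||u|||=\Big(\tfrac12\int_{\tilde\Omega}\int_{\tilde\Omega}\mathcal D^*(u)(x,y)\cdot\big(a(t,x,y)\,\mathcal D^*(u)(x,y)\big)\,dy\,dx\Big)^{1/2},$$ $$\|u\|_{H^{\beta(\cdot)}(\tilde\Omega)}=\|u\|_{L^2(\tilde\Omega)}+\Big(\int_{\tilde\Omega}\int_{\tilde\Omega}\frac{(u(y)-u(x))^2}{|y-x|^{n+2\beta(x)}}\,dy\,dx\Big)^{1/2}.$$ Consider one of two volume constraints: $E_c(u)=\int_{\Omega_{\mathcal I}}u^2\,dx$ (Dirichlet) or $E_c(u)=\big(\int_{\tilde\Omega}u\,dx\big)^2$ (Neumann). In the Neumann case assume in addition that $\epsilon<\infty$ and that any two points of $\tilde\Omega$ can be joined by a finite chain of points of $\tilde\Omega$ with consecutive distances less than $\epsilon$ (which holds, for example, if $\tilde\Omega$ is connected). Let $$V_c(\tilde\Omega)=\{u\in L^2(\tilde\Omega):\ |||u|||<\infty,\ E_c(u)=0\},\qquad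 H^{\beta(\cdot)}_c(\tilde\Omega)=\{u\in L^2(\tilde\Omega):\ \|u\|_{H^{\beta(\cdot)}(\tilde\Omega)}<\infty,\ E_c(u)=0\},$$ where the first space is formed with the norm $|||\cdot|||$ at time $t$. Then there is a constant $C>0$, independent of $t\in[0,T]$ and of $u$, such that for every $t\in[0,T]$ $$C^{-1}\|u\|_{H^{\beta(\cdot)}(\tilde\Omega)}\le|||u|||\le C\,\|u\|_{H^{\beta(\cdot)}(\tilde\Omega)}\qquad\text{for all }u\in V_c(\tilde\Omega).$$ In addition, for every $t\in[0,T]$, the spaces $H^{\beta(\cdot)}_c(\tilde\Omega)$ and $V_c(\tilde\Omega)$ coincide. -/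

import Mathlib

open MeasureTheory Set
open scoped ENNReal NNReal Matrix

noncomputable section

namespace NonlocalDiffusion

/-- Euclidean space of dimension `n`. -/
abbrev Sp (n : ℕ) : Type := EuclideanSpace ℝ (Fin n)

/-- The two kinds of volume constraints. -/
inductive VolumeConstraint : Type
  | dirichlet
  | neumann

variable {n : ℕ}

/-- The vector kernel `α(x,y) = (y - x) / |y - x| ^ (n/2 + β(x) + 1)` if `|y - x| ≤ ε`, and `0`
otherwise. The horizon `ε` is an element of `[0,∞]`. The additional restriction `y ∈ Ω ∪ Ω_I` in
the truncation is automatic below, because the kernel is used only for `x, y ∈ Ω ∪ Ω_I` (and, in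
the definition of `Ω_I`, to decide which points interact with `Ω`). -/
def alpha (β : Sp n → ℝ) (ε : ℝ≥0∞) (x y : Sp n) : Sp n :=
  open scoped Classical in
  if edist y x ≤ ε then (‖y - x‖ ^ ((n : ℝ) / 2 + β x + 1))⁻¹ • (y - x) else 0

/-- The interaction domain `Ω_I`: the points outside `Ω` that interact with a point of `Ω`. -/
def interactionDomain (β : Sp n → ℝ) (ε : ℝ≥0∞) (Ω : Set (Sp n)) : Set (Sp n) :=
  {y | y ∉ Ω ∧ ∃ x ∈ Ω, alpha β ε x y ≠ 0}

/-- The set `Ω ∪ Ω_I`. -/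
def fullDomain (β : Sp n → ℝ) (ε : ℝ≥0∞) (Ω : Set (Sp n)) : Set (Sp n) :=
  Ω ∪ interactionDomain β ε Ω

/-- The real Hilbert space `L²(Ω ∪ Ω_I)` (classes of functions modulo a.e. equality). -/
abbrev L2 (β : Sp n → ℝ) (ε : ℝ≥0∞) (Ω : Set (Sp n)) : Type :=
  Lp ℝ 2 (volume.restrict (fullDomain β ε Ω))

/-- The adjoint nonlocal divergence `D*(u)(x,y) = -(u(y) - u(x)) α(x,y)`. -/
def Dstar (β : Sp n → ℝ) (ε : ℝ≥0∞) (u : Sp n → ℝ) (x y : Sp n) : Sp n :=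
  (-(u y - u x)) • alpha β ε x y

/-- The standing assumptions on the diffusion tensor `a(t,x,y)`: entries of class `C¹` on
`[0,T] × ℝⁿ × ℝⁿ`, symmetry, uniform ellipticity with constants `aLow` and `aUp`, and the
one-sided bound on the time derivative, the last two for `x, y ∈ S` with `|y - x| ≤ ε`
(where `S` will be `Ω ∪ Ω_I`). -/
structure IsDiffusionTensor (T : ℝ) (ε : ℝ≥0∞) (S : Set (Sp n)) (aLow aUp : ℝ)
    (a : ℝ → Sp n → Sp n → Matrix (Fin n) (Fin n) ℝ) : Prop where
  contDiffOn : ∀ i j, ContDiffOn ℝ 1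
    (fun p : ℝ × Sp n × Sp n => a p.1 p.2.1 p.2.2 i j) (Icc (0 : ℝ) T ×ˢ univ)
  symm : ∀ t ∈ Icc (0 : ℝ) T, ∀ x y i j, a t x y i j = a t x y j i
  aLow_pos : 0 < aLow
  lower : ∀ t ∈ Icc (0 : ℝ) T, ∀ x ∈ S, ∀ y ∈ S, edist y x ≤ ε → ∀ ξ : Sp n,
    aLow * ‖ξ‖ ^ 2 ≤ ∑ i, ∑ j, a t x y i j * ξ i * ξ j
  upper : ∀ t ∈ Icc (0 : ℝ) T, ∀ x ∈ S, ∀ y ∈ S, edist y x ≤ ε → ∀ ξ : Sp n,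
    ∑ i, ∑ j, a t x y i j * ξ i * ξ j ≤ aUp * ‖ξ‖ ^ 2
  deriv_upper : ∀ t ∈ Icc (0 : ℝ) T, ∀ x ∈ S, ∀ y ∈ S, edist y x ≤ ε → ∀ ξ : Sp n,
    ∑ i, ∑ j, derivWithin (fun s => a s x y i j) (Icc (0 : ℝ) T) t * ξ i * ξ j ≤ aUp * ‖ξ‖ ^ 2

/-- The nonlocal energy norm at time `t`, with values in `[0,∞]`:
`|||u|||² = 1/2 ∫∫ D*(u)(x,y) · (a(t,x,y) D*(u)(x,y)) dy dx`, both integrals over `Ω ∪ Ω_I`. -/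
def energyNorm (β : Sp n → ℝ) (ε : ℝ≥0∞) (Ω : Set (Sp n))
    (a : ℝ → Sp n → Sp n → Matrix (Fin n) (Fin n) ℝ) (t : ℝ) (u : L2 β ε Ω) : ℝ≥0∞ :=
  (2⁻¹ * ∫⁻ x in fullDomain β ε Ω, ∫⁻ y in fullDomain β ε Ω,
    ENNReal.ofReal ((Dstar β ε u x y).ofLp ⬝ᵥ (a t x y *ᵥ (Dstar β ε u x y).ofLp)))
      ^ (1 / 2 : ℝ)

/-- The seminorm `|u|` of the variable-order Sobolev space, with values in `[0,∞]`:
`|u|² = ∫∫ (u(y) - u(x))² / |y - x| ^ (n + 2 β(x)) dy dx`, both integrals over `Ω ∪ Ω_I`. -/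
def sobolevSeminorm (β : Sp n → ℝ) (ε : ℝ≥0∞) (Ω : Set (Sp n)) (u : L2 β ε Ω) : ℝ≥0∞ :=
  (∫⁻ x in fullDomain β ε Ω, ∫⁻ y in fullDomain β ε Ω,
    ENNReal.ofReal ((u y - u x) ^ 2 / ‖y - x‖ ^ ((n : ℝ) + 2 * β x))) ^ (1 / 2 : ℝ)

/-- The norm of the variable-order Sobolev space, with values in `[0,∞]`:
the `L²` norm plus the seminorm. -/
def sobolevNorm (β : Sp n → ℝ) (ε : ℝ≥0∞) (Ω : Set (Sp n)) (u : L2 β ε Ω) : ℝ≥0∞ :=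
  ‖u‖ₑ + sobolevSeminorm β ε Ω u

/-- The constraint functional `E_c`: the integral of `u²` over `Ω_I` in the Dirichlet case, and the
square of the integral of `u` over `Ω ∪ Ω_I` in the Neumann case. -/
def constraintFunctional (c : VolumeConstraint) (β : Sp n → ℝ) (ε : ℝ≥0∞) (Ω : Set (Sp n))
    (u : L2 β ε Ω) : ℝ :=
  match c with
  | .dirichlet => ∫ x in interactionDomain β ε Ω, (u x) ^ 2
  | .neumann => (∫ x in fullDomain β ε Ω, u x) ^ 2

/-- The nonlocal energy space `V(Ω ∪ Ω_I)` (at time `t`). -/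
def energySpace (β : Sp n → ℝ) (ε : ℝ≥0∞) (Ω : Set (Sp n))
    (a : ℝ → Sp n → Sp n → Matrix (Fin n) (Fin n) ℝ) (t : ℝ) : Set (L2 β ε Ω) :=
  {u | energyNorm β ε Ω a t u < ∞}

/-- The nonlocal volume-constrained energy space `V_c(Ω ∪ Ω_I)` (at time `t`). -/
def constrainedEnergySpace (c : VolumeConstraint) (β : Sp n → ℝ) (ε : ℝ≥0∞) (Ω : Set (Sp n))
    (a : ℝ → Sp n → Sp n → Matrix (Fin n) (Fin n) ℝ) (t : ℝ) : Set (L2 β ε Ω) :=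
  {u ∈ energySpace β ε Ω a t | constraintFunctional c β ε Ω u = 0}

/-- The variable-order Sobolev space on `Ω ∪ Ω_I`. -/
def sobolevSpace (β : Sp n → ℝ) (ε : ℝ≥0∞) (Ω : Set (Sp n)) : Set (L2 β ε Ω) :=
  {u | sobolevNorm β ε Ω u < ∞}

/-- The constrained variable-order Sobolev space on `Ω ∪ Ω_I`. -/
def constrainedSobolevSpace (c : VolumeConstraint) (β : Sp n → ℝ) (ε : ℝ≥0∞)
    (Ω : Set (Sp n)) : Set (L2 β ε Ω) :=
  {u ∈ sobolevSpace β ε Ω | constraintFunctional c β ε Ω u = 0}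

/-- Any two points of `S` are joined by a finite chain of points of `S` in which consecutive points
have distance less than `ε`. Every connected set has this property (for `ε > 0`). -/
def IsChainConnected (ε : ℝ≥0∞) (S : Set (Sp n)) : Prop :=
  ∀ x ∈ S, ∀ y ∈ S,
    Relation.ReflTransGen (fun p q : Sp n => p ∈ S ∧ q ∈ S ∧ edist p q < ε) x y

end NonlocalDiffusion

end

/-!
By ellipticity the energy density is comparable to the Gagliardo density
`(u y - u x)² / |y - x| ^ (n + 2 β x)` for `|y - x| ≤ ε`. Pairs with `|y - x| > ε` occur only if
`ε < ∞`; then the domain has finite measure and their contribution to the Sobolev seminorm is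
bounded by the `L²` norm. It remains to bound the `L²` norm by the energy.

The unweighted energy `∫∫_{|y - x| < R} (u y - u x)²`, which the energy norm dominates for `R ≤ ε`,
controls the mean square oscillation of `u` between two small balls at distance less than `R`, and
this control propagates along finite chains of balls. By total boundedness it yields a Poincaré
inequality as soon as every point is joined by a chain to all the others (for functions of mean
zero) or to the interior of a set on which `u` vanishes. In the Dirichlet case such chains always
exist: among the points of `Ω` that can be reached from a given one, take one of nearly maximal
norm; moving radially outward from it by `R / 2` leads out of the closure of `Ω`, hence into the
interior of the interaction domain.
-/

noncomputable section

namespace NonlocalDiffusion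

section Oscillation

variable {X E : Type*} [MeasurableSpace X] {μ : Measure X} {U V W U' V' : Set X}

section PseudoEMetric

variable [PseudoEMetricSpace E] {u : X → E}

/-- The mean square oscillation of `u` between `U` and `V`, not normalised by the measures of
`U` and `V`. -/
def oscillation (μ : Measure X) (u : X → E) (U V : Set X) : ℝ≥0∞ :=
  ∫⁻ x in U, ∫⁻ y in V, edist (u x) (u y) ^ 2 ∂μ ∂μ

theorem edist_sq_triangle (a b c : E) :
    edist a c ^ 2 ≤ 2 * (edist a b ^ 2 + edist b c ^ 2) := by
  calc edist a c ^ 2 ≤ (edist a b + edist b c) ^ 2 := by gcongr; exact edist_triangle a b c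
    _ ≤ 2 * (edist a b ^ 2 + edist b c ^ 2) := by
      have h := ENNReal.rpow_add_le_mul_rpow_add_rpow (edist a b) (edist b c) one_le_two
      norm_num at h
      exact_mod_cast h

theorem oscillation_mono (hU : U' ⊆ U) (hV : V' ⊆ V) :
    oscillation μ u U' V' ≤ oscillation μ u U V :=
  (lintegral_mono_set hU).trans (lintegral_mono fun _ => lintegral_mono_set hV)

theorem oscillation_union_left_le (U U' V : Set X) :
    oscillation μ u (U ∪ U') V ≤ oscillation μ u U V + oscillation μ u U' V :=
  lintegral_union_le _ _ _

theorem oscillation_eq_of_ae_eq_const {e : E} (h : ∀ᵐ y ∂μ.restrict V, u y = e)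
    (hV : μ V ≠ ∞) : oscillation μ u U V = μ V * ∫⁻ x in U, edist (u x) e ^ 2 ∂μ := by
  rw [← lintegral_const_mul' _ _ hV]
  refine lintegral_congr fun x => ?_
  rw [mul_comm, ← setLIntegral_const]
  refine lintegral_congr_ae ?_
  filter_upwards [h] with y hy
  rw [hy]

variable [MeasurableSpace E] [OpensMeasurableSpace E] [SecondCountableTopology E]

theorem measurable_edist_sq (hu : Measurable u) :
    Measurable fun p : X × X => edist (u p.1) (u p.2) ^ 2 :=
  ((hu.comp measurable_fst).edist (hu.comp measurable_snd)).pow_const 2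

variable [SFinite μ]

theorem oscillation_comm (hu : Measurable u) (U V : Set X) :
    oscillation μ u U V = oscillation μ u V U := by
  rw [oscillation, lintegral_lintegral_swap (measurable_edist_sq hu).aemeasurable]
  simp_rw [oscillation, edist_comm]

theorem measure_mul_oscillation_le (hu : Measurable u) (U V W : Set X) :
    μ V * oscillation μ u U W ≤ 2 * (μ W * oscillation μ u U V + μ U * oscillation μ u V W) := by
  have hright : ∀ x, Measurable fun y => edist (u x) (u y) ^ 2 := fun x => by fun_prop
  calc μ V * oscillation μ u U W
      = ∫⁻ x in U, ∫⁻ z in W, ∫⁻ _ in V, edist (u x) (u z) ^ 2 ∂μ ∂μ ∂μ := by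
        simp_rw [oscillation, setLIntegral_const]
        rw [mul_comm, ← lintegral_mul_const _ (by fun_prop)]
        refine lintegral_congr fun x => ?_
        rw [lintegral_mul_const _ (by fun_prop)]
    _ ≤ ∫⁻ x in U, ∫⁻ z in W, ∫⁻ y in V,
          2 * (edist (u x) (u y) ^ 2 + edist (u z) (u y) ^ 2) ∂μ ∂μ ∂μ :=
        lintegral_mono fun x => lintegral_mono fun z => lintegral_mono fun y => by
          rw [edist_comm (u z)]
          exact edist_sq_triangle _ _ _
    _ = 2 * (μ W * oscillation μ u U V + μ U * oscillation μ u W V) := by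
        simp_rw [oscillation, lintegral_const_mul' _ _ ENNReal.ofNat_ne_top,
          lintegral_add_left (hright _),
          lintegral_add_left measurable_const, setLIntegral_const]
        rw [lintegral_add_right _ measurable_const, setLIntegral_const,
          lintegral_mul_const _ (by fun_prop), mul_comm (μ W), mul_comm (μ U)]
    _ = _ := by rw [oscillation_comm hu W V]

end PseudoEMetric

theorem oscillation_self_le [SeminormedAddCommGroup E] (u : X → E) (hU : μ U ≠ ∞) :
    oscillation μ u U U ≤ 4 * μ U * ∫⁻ x in U, ‖u x‖ₑ ^ 2 ∂μ := by
  calc oscillation μ u U U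
      ≤ ∫⁻ x in U, ∫⁻ y in U, 2 * (‖u x‖ₑ ^ 2 + ‖u y‖ₑ ^ 2) ∂μ ∂μ :=
        lintegral_mono fun x => lintegral_mono fun y => by
          simpa only [edist_comm (0 : E), edist_zero_right] using edist_sq_triangle (u x) 0 (u y)
    _ = 4 * μ U * ∫⁻ x in U, ‖u x‖ₑ ^ 2 ∂μ := by
        simp_rw [lintegral_const_mul' _ _ ENNReal.ofNat_ne_top,
          lintegral_add_left measurable_const, setLIntegral_const]
        rw [lintegral_add_right _ measurable_const, setLIntegral_const,
          lintegral_mul_const' _ _ hU]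
        ring

theorem measure_mul_lintegral_enorm_sq_le_oscillation {u : X → ℝ} (hU : μ U ≠ ∞)
    (hu : MemLp u 2 (μ.restrict U)) (hmean : ∫ x in U, u x ∂μ = 0) :
    μ U * ∫⁻ x in U, ‖u x‖ₑ ^ 2 ∂μ ≤ oscillation μ u U U := by
  have : IsFiniteMeasure (μ.restrict U) := isFiniteMeasure_restrict.2 hU
  have hint : Integrable u (μ.restrict U) := hu.integrable one_le_two
  rw [← lintegral_const_mul' _ _ hU]
  refine lintegral_mono fun x => ?_
  have hexpand : ∀ y, (u x - u y) ^ 2 = u x ^ 2 - 2 * u x * u y + u y ^ 2 := fun y => by ring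
  have hint_lin : Integrable (fun y => u x ^ 2 - 2 * u x * u y) (μ.restrict U) :=
    (integrable_const _).sub (hint.const_mul _)
  have hint_sq : Integrable (fun y => (u x - u y) ^ 2) (μ.restrict U) := by
    simp_rw [hexpand]
    exact hint_lin.add hu.integrable_sq
  have hreal : μ.real U * u x ^ 2 ≤ ∫ y in U, (u x - u y) ^ 2 ∂μ := by
    simp_rw [hexpand]
    rw [integral_add hint_lin hu.integrable_sq,
      integral_sub (integrable_const _) (hint.const_mul _), integral_const_mul, hmean, mul_zero,
      sub_zero, setIntegral_const, smul_eq_mul]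
    exact le_add_of_nonneg_right (integral_nonneg fun y => sq_nonneg _)
  calc μ U * ‖u x‖ₑ ^ 2 = ENNReal.ofReal (μ.real U * u x ^ 2) := by
        rw [ENNReal.ofReal_mul measureReal_nonneg, ofReal_measureReal hU, ← enorm_pow,
          Real.enorm_of_nonneg (sq_nonneg _)]
    _ ≤ ENNReal.ofReal (∫ y in U, (u x - u y) ^ 2 ∂μ) := ENNReal.ofReal_le_ofReal hreal
    _ = ∫⁻ y in U, edist (u x) (u y) ^ 2 ∂μ := by
        rw [ofReal_integral_eq_lintegral_ofReal hint_sq (.of_forall fun y => sq_nonneg _)]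
        refine lintegral_congr fun y => ?_
        rw [edist_eq_enorm_sub, ← enorm_pow, Real.enorm_of_nonneg (sq_nonneg _)]

end Oscillation

section Poincare

theorem totallyBounded_induction {X : Type*} [PseudoMetricSpace X] {P : Set X → Prop} {A : Set X}
    {r : ℝ} (hA : TotallyBounded A) (hr : 0 < r) (empty : P ∅) (mono : ∀ ⦃s t⦄, s ⊆ t → P t → P s)
    (union : ∀ ⦃s t⦄, P s → P t → P (s ∪ t)) (ball : ∀ p ∈ A, P (A ∩ Metric.ball p r)) : P A := by
  obtain ⟨t, htA, ht, hcover⟩ := Metric.finite_approx_of_totallyBounded hA r hr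
  have hP : P (⋃ p ∈ t, A ∩ Metric.ball p r) := by
    clear hcover
    induction t, ht using Set.Finite.induction_on with
    | empty => simpa using empty
    | insert _ _ ih =>
      rw [biUnion_insert]
      exact union (ball _ (htA (mem_insert _ _))) (ih ((subset_insert _ _).trans htA))
  refine mono ?_ hP
  rw [← inter_iUnion₂]
  exact subset_inter subset_rfl hcover

variable {X : Type*} [PseudoMetricSpace X] [MeasurableSpace X] {μ : Measure X}
  {S U V W Z U' V' : Set X} {R : ℝ} {p q : X}

/-- The unweighted interaction energy of `u` over the pairs of points of `S` at distance less than
`R`; it bounds the energies of all kernels that are bounded below near the diagonal. -/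
def nearEnergy (μ : Measure X) (S : Set X) (R : ℝ) (u : X → ℝ) : ℝ≥0∞ :=
  ∫⁻ x in S, ∫⁻ y in S ∩ Metric.ball x R, edist (u x) (u y) ^ 2 ∂μ ∂μ

/-- The interaction energy over pairs of points of `S` at distance less than `R` controls the mean
square oscillation between `U` and `V`, with a constant that does not depend on the function. -/
def OscillationControlled (μ : Measure X) (S : Set X) (R : ℝ) (U V : Set X) : Prop :=
  ∃ C : ℝ≥0, ∀ u : X → ℝ, Measurable u → oscillation μ u U V ≤ C * nearEnergy μ S R u

/-- The Poincaré inequality on `U` for functions vanishing almost everywhere on `Z`. -/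
def PoincareVanishingOn (μ : Measure X) (S : Set X) (R : ℝ) (Z U : Set X) : Prop :=
  ∃ C : ℝ≥0, ∀ u : X → ℝ, Measurable u → (∀ᵐ y ∂μ.restrict Z, u y = 0) →
    ∫⁻ x in U, ‖u x‖ₑ ^ 2 ∂μ ≤ C * nearEnergy μ S R u

/-- One step of a chain in `S` with consecutive distances less than `R`. -/
def ChainStep (S : Set X) (R : ℝ) (p q : X) : Prop :=
  p ∈ S ∧ q ∈ S ∧ dist p q < R

namespace OscillationControlled

theorem of_dist_lt (hU : MeasurableSet U) (hUS : U ⊆ S) (hVS : V ⊆ S)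
    (h : ∀ x ∈ U, ∀ y ∈ V, dist y x < R) : OscillationControlled μ S R U V := by
  refine ⟨1, fun u _ => ?_⟩
  rw [ENNReal.coe_one, one_mul]
  refine (setLIntegral_mono' hU fun x hx => ?_).trans (lintegral_mono_set hUS)
  exact lintegral_mono_set fun y hy => ⟨hVS hy, h x hx y hy⟩

theorem empty_left (V : Set X) : OscillationControlled μ S R ∅ V :=
  ⟨0, fun u _ => by simp [oscillation]⟩

theorem mono (h : OscillationControlled μ S R U V) (hU : U' ⊆ U) (hV : V' ⊆ V) :
    OscillationControlled μ S R U' V' :=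
  let ⟨C, hC⟩ := h
  ⟨C, fun u hu => (oscillation_mono hU hV).trans (hC u hu)⟩

theorem union_left (h : OscillationControlled μ S R U V) (h' : OscillationControlled μ S R U' V) :
    OscillationControlled μ S R (U ∪ U') V := by
  obtain ⟨C, hC⟩ := h
  obtain ⟨C', hC'⟩ := h'
  refine ⟨C + C', fun u hu => ?_⟩
  rw [ENNReal.coe_add, add_mul]
  exact (oscillation_union_left_le U U' V).trans (add_le_add (hC u hu) (hC' u hu))

theorem poincareVanishingOn (h : OscillationControlled μ S R U V) (hVZ : V ⊆ Z) (hV0 : μ V ≠ 0)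
    (hV : μ V ≠ ∞) : PoincareVanishingOn μ S R Z U := by
  obtain ⟨C, hC⟩ := h
  refine ⟨(μ V).toNNReal⁻¹ * C, fun u hu hz => ?_⟩
  rw [ENNReal.coe_mul, ENNReal.coe_inv (ENNReal.toNNReal_ne_zero.2 ⟨hV0, hV⟩),
    ENNReal.coe_toNNReal hV, mul_assoc, ← ENNReal.mul_le_iff_le_inv hV0 hV]
  simpa only [oscillation_eq_of_ae_eq_const (ae_restrict_of_ae_restrict_of_subset hVZ hz) hV,
    edist_zero_right] using hC u hu

variable [SFinite μ]

theorem symm (h : OscillationControlled μ S R U V) : OscillationControlled μ S R V U :=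
  let ⟨C, hC⟩ := h
  ⟨C, fun u hu => (oscillation_comm hu V U).trans_le (hC u hu)⟩

theorem trans (h₁ : OscillationControlled μ S R U V) (h₂ : OscillationControlled μ S R V W)
    (hV0 : μ V ≠ 0) (hV : μ V ≠ ∞) (hU : μ U ≠ ∞) (hW : μ W ≠ ∞) :
    OscillationControlled μ S R U W := by
  obtain ⟨C₁, h₁⟩ := h₁
  obtain ⟨C₂, h₂⟩ := h₂
  refine ⟨(μ V).toNNReal⁻¹ * (2 * ((μ W).toNNReal * C₁ + (μ U).toNNReal * C₂)), fun u hu => ?_⟩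
  rw [ENNReal.coe_mul, ENNReal.coe_inv (ENNReal.toNNReal_ne_zero.2 ⟨hV0, hV⟩),
    ENNReal.coe_toNNReal hV, mul_assoc, ← ENNReal.mul_le_iff_le_inv hV0 hV]
  calc μ V * oscillation μ u U W
      ≤ 2 * (μ W * oscillation μ u U V + μ U * oscillation μ u V W) :=
        measure_mul_oscillation_le hu U V W
    _ ≤ 2 * (μ W * (C₁ * nearEnergy μ S R u) + μ U * (C₂ * nearEnergy μ S R u)) := by
        gcongr
        exacts [h₁ u hu, h₂ u hu]
    _ = _ := by
        push_cast [ENNReal.coe_toNNReal hU, ENNReal.coe_toNNReal hW]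
        ring

end OscillationControlled

namespace PoincareVanishingOn

theorem empty (Z : Set X) : PoincareVanishingOn μ S R Z ∅ :=
  ⟨0, fun u _ _ => by simp⟩

theorem mono (h : PoincareVanishingOn μ S R Z U) (hU : U' ⊆ U) : PoincareVanishingOn μ S R Z U' :=
  let ⟨C, hC⟩ := h
  ⟨C, fun u hu hz => (lintegral_mono_set hU).trans (hC u hu hz)⟩

theorem union (h : PoincareVanishingOn μ S R Z U) (h' : PoincareVanishingOn μ S R Z U') :
    PoincareVanishingOn μ S R Z (U ∪ U') := by
  obtain ⟨C, hC⟩ := h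
  obtain ⟨C', hC'⟩ := h'
  refine ⟨C + C', fun u hu hz => ?_⟩
  rw [ENNReal.coe_add, add_mul]
  exact (lintegral_union_le _ _ _).trans (add_le_add (hC u hu hz) (hC' u hu hz))

end PoincareVanishingOn

open Filter Topology

variable [BorelSpace X]

theorem eventually_oscillationControlled_ball (hS : IsOpen S) (h : ChainStep S R p q) :
    ∀ᶠ δ in 𝓝[>] (0 : ℝ), OscillationControlled μ S R (Metric.ball p δ) (Metric.ball q δ) := by
  obtain ⟨hp, hq, hpq⟩ := h
  obtain ⟨r₁, hr₁, hpS⟩ := Metric.isOpen_iff.1 hS p hp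
  obtain ⟨r₂, hr₂, hqS⟩ := Metric.isOpen_iff.1 hS q hq
  filter_upwards [Ioo_mem_nhdsGT hr₁, Ioo_mem_nhdsGT hr₂,
    Ioo_mem_nhdsGT (show 0 < (R - dist p q) / 2 by linarith)] with δ hδ₁ hδ₂ hδ
  refine .of_dist_lt measurableSet_ball ((Metric.ball_subset_ball hδ₁.2.le).trans hpS)
    ((Metric.ball_subset_ball hδ₂.2.le).trans hqS) fun x hx y hy => ?_
  have htri := dist_triangle4 y q p x
  rw [dist_comm p x, dist_comm q p] at htri
  linarith [Metric.mem_ball.1 hx, Metric.mem_ball.1 hy, hδ.2]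

theorem eventually_oscillationControlled_inter_ball (hS : IsOpen S) (hR : 0 < R) (hp : p ∈ S) :
    ∀ᶠ δ in 𝓝[>] (0 : ℝ),
      OscillationControlled μ S R (S ∩ Metric.ball p (R / 2)) (Metric.ball p δ) := by
  obtain ⟨r, hr, hpS⟩ := Metric.isOpen_iff.1 hS p hp
  filter_upwards [Ioo_mem_nhdsGT hr, Ioo_mem_nhdsGT (half_pos hR)] with δ hδr hδR
  refine .of_dist_lt (hS.inter Metric.isOpen_ball).measurableSet inter_subset_left
    ((Metric.ball_subset_ball hδr.2.le).trans hpS) fun x hx y hy => ?_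
  linarith [dist_triangle_right y x p, Metric.mem_ball.1 hx.2, Metric.mem_ball.1 hy, hδR.2]

variable [ProperSpace X] [IsFiniteMeasureOnCompacts μ] [μ.IsOpenPosMeasure]

theorem eventually_oscillationControlled_of_chain (hS : IsOpen S) (hR : 0 < R) (hp : p ∈ S)
    (h : Relation.ReflTransGen (ChainStep S R) p q) :
    ∀ᶠ δ in 𝓝[>] (0 : ℝ),
      OscillationControlled μ S R (S ∩ Metric.ball p (R / 2)) (Metric.ball q δ) := by
  induction h with
  | refl => exact eventually_oscillationControlled_inter_ball hS hR hp
  | tail _ hstep ih =>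
    filter_upwards [ih, eventually_oscillationControlled_ball (μ := μ) hS hstep,
      self_mem_nhdsWithin] with δ hchain hlast hδ
    exact hchain.trans hlast (Metric.measure_ball_pos μ _ hδ).ne' measure_ball_lt_top.ne
      (measure_ne_top_of_subset inter_subset_right measure_ball_lt_top.ne) measure_ball_lt_top.ne

theorem oscillationControlled_inter_ball_of_chain (hS : IsOpen S) (hR : 0 < R) (hp : p ∈ S)
    (hq : q ∈ S) (h : Relation.ReflTransGen (ChainStep S R) p q) :
    OscillationControlled μ S R (S ∩ Metric.ball p (R / 2)) (S ∩ Metric.ball q (R / 2)) := by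
  obtain ⟨δ, ⟨hpδ, hqδ⟩, hδ⟩ := ((eventually_oscillationControlled_of_chain (μ := μ) hS hR hp
    h).and (eventually_oscillationControlled_inter_ball hS hR hq)).and self_mem_nhdsWithin |>.exists
  have hfin : ∀ x : X, μ (S ∩ Metric.ball x (R / 2)) ≠ ∞ := fun x =>
    measure_ne_top_of_subset inter_subset_right measure_ball_lt_top.ne
  exact hpδ.trans hqδ.symm (Metric.measure_ball_pos μ q hδ).ne' measure_ball_lt_top.ne
    (hfin p) (hfin q)

theorem oscillationControlled_self (hS : IsOpen S) (hb : TotallyBounded S) (hR : 0 < R)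
    (h : ∀ x ∈ S, ∀ y ∈ S, Relation.ReflTransGen (ChainStep S R) x y) :
    OscillationControlled μ S R S S := by
  refine totallyBounded_induction (P := (OscillationControlled μ S R · S)) hb (half_pos hR)
    (.empty_left S) (fun _ _ hst ht => ht.mono hst subset_rfl) (fun _ _ => .union_left)
    fun p hp => ?_
  refine .symm <| totallyBounded_induction
    (P := (OscillationControlled μ S R · (S ∩ Metric.ball p (R / 2)))) hb (half_pos hR)
    (.empty_left _) (fun _ _ hst ht => ht.mono hst subset_rfl) (fun _ _ => .union_left)
    fun q hq => ?_
  exact oscillationControlled_inter_ball_of_chain hS hR hq hp (h q hq p hp)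

theorem poincareVanishingOn_of_chain (hS : IsOpen S) (hUS : U ⊆ S) (hb : TotallyBounded U)
    (hR : 0 < R)
    (h : ∀ p ∈ U, ∃ q ∈ interior Z, Relation.ReflTransGen (ChainStep S R) p q) :
    PoincareVanishingOn μ S R Z U := by
  refine totallyBounded_induction hb (half_pos hR) (.empty Z) (fun _ _ hst ht => ht.mono hst)
    (fun _ _ => .union) fun p hp => ?_
  obtain ⟨q, hqZ, hpq⟩ := h p hp
  obtain ⟨r, hr, hrZ⟩ := Metric.mem_nhds_iff.1 (mem_interior_iff_mem_nhds.1 hqZ)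
  obtain ⟨δ, hcontrol, hδ⟩ := ((eventually_oscillationControlled_of_chain (μ := μ) hS hR
    (hUS hp) hpq).and (Ioo_mem_nhdsGT hr)).exists
  exact (hcontrol.poincareVanishingOn ((Metric.ball_subset_ball hδ.2.le).trans hrZ)
    (Metric.measure_ball_pos μ q hδ.1).ne' measure_ball_lt_top.ne).mono
      (inter_subset_inter_left _ hUS)

theorem exists_lintegral_enorm_sq_le_of_integral_eq_zero (hS : IsOpen S) (hb : TotallyBounded S)
    (hR : 0 < R) (h : ∀ x ∈ S, ∀ y ∈ S, Relation.ReflTransGen (ChainStep S R) x y) :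
    ∃ C : ℝ≥0, ∀ u : X → ℝ, Measurable u → MemLp u 2 (μ.restrict S) → ∫ x in S, u x ∂μ = 0 →
      ∫⁻ x in S, ‖u x‖ₑ ^ 2 ∂μ ≤ C * nearEnergy μ S R u := by
  obtain ⟨C, hC⟩ := oscillationControlled_self (μ := μ) hS hb hR h
  rcases S.eq_empty_or_nonempty with rfl | hne
  · exact ⟨0, fun u _ _ _ => by simp⟩
  have hS0 : μ S ≠ 0 := (hS.measure_pos μ hne).ne'
  have hS_top : μ S ≠ ∞ := hb.isBounded.measure_lt_top.ne
  refine ⟨(μ S).toNNReal⁻¹ * C, fun u hu hL2 hmean => ?_⟩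
  rw [ENNReal.coe_mul, ENNReal.coe_inv (ENNReal.toNNReal_ne_zero.2 ⟨hS0, hS_top⟩),
    ENNReal.coe_toNNReal hS_top, mul_assoc, ← ENNReal.mul_le_iff_le_inv hS0 hS_top]
  exact (measure_mul_lintegral_enorm_sq_le_oscillation hS_top hL2 hmean).trans (hC u hu)

end Poincare

section Chains

variable {E : Type*} [NormedAddCommGroup E] [NormedSpace ℝ E] [Nontrivial E] {Ω : Set E} {R : ℝ}

theorem exists_dist_eq_norm_eq_add (x : E) {r : ℝ} (hr : 0 ≤ r) :
    ∃ y, dist x y = r ∧ ‖y‖ = ‖x‖ + r := by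
  rcases eq_or_ne x 0 with rfl | hx
  · obtain ⟨y, hy⟩ := exists_norm_eq E hr
    exact ⟨y, by simpa using hy, by simpa using hy⟩
  · have hnorm : ‖(r / ‖x‖) • x‖ = r := by
      rw [norm_smul, Real.norm_of_nonneg (by positivity), div_mul_cancel₀ r (norm_ne_zero_iff.2 hx)]
    refine ⟨x + (r / ‖x‖) • x, by rw [dist_self_add_right, hnorm], ?_⟩
    rw [(SameRay.sameRay_nonneg_smul_right x (by positivity)).norm_add, hnorm]

theorem exists_chain_dist_lt_notMem_closure (hb : Bornology.IsBounded Ω) (hR : 0 < R) {p : E}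
    (hp : p ∈ Ω) :
    ∃ p' ∈ Ω, ∃ q ∉ closure Ω, Relation.ReflTransGen (ChainStep Ω R) p p' ∧ dist p' q < R := by
  set reachable : Set E := {x ∈ Ω | Relation.ReflTransGen (ChainStep Ω R) p x}
  have hbdd : BddAbove (norm '' reachable) :=
    (lipschitzWith_one_norm.isBounded_image (hb.subset (sep_subset _ _))).bddAbove
  have hne : reachable.Nonempty := ⟨p, hp, .refl⟩
  obtain ⟨-, ⟨p', ⟨hp', hchain⟩, rfl⟩, hp'_far⟩ :=
    exists_lt_of_lt_csSup (hne.image norm)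
      (sub_lt_self (sSup (norm '' reachable)) (show 0 < R / 4 by linarith))
  obtain ⟨q, hdist, hnorm⟩ := exists_dist_eq_norm_eq_add p' (half_pos hR).le
  refine ⟨p', hp', q, fun hq => ?_, hchain, by linarith⟩
  obtain ⟨z, hz, hqz⟩ := Metric.mem_closure_iff.1 hq (R / 4) (by linarith)
  have hz_reachable : z ∈ reachable :=
    ⟨hz, hchain.tail ⟨hp', hz, by linarith [dist_triangle p' q z]⟩⟩
  have hz_le : ‖z‖ ≤ sSup (norm '' reachable) := le_csSup hbdd (mem_image_of_mem _ hz_reachable)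
  rw [dist_eq_norm] at hqz
  linarith [norm_le_norm_add_norm_sub' q z]

end Chains

theorem enorm_sq_eq_lintegral {X E : Type*} [MeasurableSpace X] {μ : Measure X}
    [NormedAddCommGroup E] (u : Lp E 2 μ) : ‖u‖ₑ ^ 2 = ∫⁻ x, ‖u x‖ₑ ^ 2 ∂μ := by
  rw [Lp.enorm_def]
  simpa only [NNReal.coe_ofNat, ENNReal.coe_ofNat, ENNReal.rpow_ofNat] using
    eLpNorm_nnreal_pow_eq_lintegral (f := u) (μ := μ) (p := 2) two_ne_zero

section Domain

open scoped Pointwise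

variable {n : ℕ} {β : Sp n → ℝ} {ε : ℝ≥0∞} {Ω : Set (Sp n)}

theorem alpha_ne_zero_iff {x y : Sp n} : alpha β ε x y ≠ 0 ↔ edist y x ≤ ε ∧ y ≠ x := by
  unfold alpha
  split_ifs with h
  · rw [smul_ne_zero_iff, sub_ne_zero]
    refine ⟨fun h' => ⟨h, h'.2⟩, fun h' => ⟨?_, h'.2⟩⟩
    exact inv_ne_zero (Real.rpow_pos_of_pos (norm_pos_iff.2 (sub_ne_zero.2 h'.2)) _).ne'
  · simp [h]

theorem mem_fullDomain_iff {y : Sp n} : y ∈ fullDomain β ε Ω ↔ ∃ x ∈ Ω, edist y x ≤ ε := by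
  simp only [fullDomain, interactionDomain, mem_union, mem_ofPred_eq, alpha_ne_zero_iff]
  constructor
  · rintro (h | ⟨-, x, hx, h, -⟩)
    exacts [⟨y, h, by simp⟩, ⟨x, hx, h⟩]
  · rintro ⟨x, hx, h⟩
    by_cases hy : y ∈ Ω
    exacts [.inl hy, .inr ⟨hy, x, hx, h, fun e => hy (e ▸ hx)⟩]

theorem fullDomain_diff_subset_interactionDomain :
    fullDomain β ε Ω \ Ω ⊆ interactionDomain β ε Ω :=
  union_sdiff_left.trans_subset sdiff_subset

theorem fullDomain_eq_add : fullDomain β ε Ω = Ω + Metric.closedEBall 0 ε := by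
  ext y
  simp only [mem_fullDomain_iff, mem_add, Metric.mem_closedEBall, edist_zero_right]
  constructor
  · rintro ⟨x, hx, h⟩
    exact ⟨x, hx, y - x, by rwa [← edist_eq_enorm_sub], add_sub_cancel x y⟩
  · rintro ⟨x, hx, z, hz, rfl⟩
    exact ⟨x, hx, by rwa [edist_eq_enorm_sub, add_sub_cancel_left]⟩

theorem isOpen_fullDomain (hΩ : IsOpen Ω) : IsOpen (fullDomain β ε Ω) :=
  fullDomain_eq_add ▸ hΩ.add_right

theorem isBounded_fullDomain (hΩb : Bornology.IsBounded Ω) (hε : ε ≠ ∞) :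
    Bornology.IsBounded (fullDomain β ε Ω) := by
  have hball : Bornology.IsBounded (Metric.closedEBall (0 : Sp n) ε) := by
    rw [← ENNReal.ofReal_toReal hε, Metric.closedEBall_ofReal ENNReal.toReal_nonneg]
    exact Metric.isBounded_closedBall
  exact fullDomain_eq_add ▸ hΩb.add hball

theorem exists_chain_interior_interactionDomain (hn : 1 ≤ n) (hΩ : IsOpen Ω)
    (hΩb : Bornology.IsBounded Ω) {R : ℝ} (hR : 0 < R) (hRε : ENNReal.ofReal R ≤ ε) {p : Sp n}
    (hp : p ∈ Ω) :
    ∃ q ∈ interior (interactionDomain β ε Ω),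
      Relation.ReflTransGen (ChainStep (fullDomain β ε Ω) R) p q := by
  have : Nonempty (Fin n) := ⟨⟨0, hn⟩⟩
  obtain ⟨p', hp', q, hq, hchain, hdist⟩ := exists_chain_dist_lt_notMem_closure hΩb hR hp
  have hΩS : Ω ⊆ fullDomain β ε Ω := subset_union_left
  have hqS : q ∈ fullDomain β ε Ω := mem_fullDomain_iff.2 ⟨p', hp', by
    rw [edist_comm, edist_dist]
    exact (ENNReal.ofReal_le_ofReal hdist.le).trans hRε⟩
  refine ⟨q, interior_maximal ?_ ((isOpen_fullDomain hΩ).sdiff isClosed_closure) ⟨hqS, hq⟩, ?_⟩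
  · exact (sdiff_subset_sdiff_right subset_closure).trans fullDomain_diff_subset_interactionDomain
  · have hmono : ChainStep Ω R ≤ ChainStep (fullDomain β ε Ω) R :=
      fun _ _ h => ⟨hΩS h.1, hΩS h.2.1, h.2.2⟩
    exact .tail (Relation.ReflTransGen.mono hmono _ _ hchain) ⟨hΩS hp', hqS, hdist⟩

theorem ae_eq_zero_of_dirichlet {u : L2 β ε Ω} (hu : constraintFunctional .dirichlet β ε Ω u = 0) :
    ∀ᵐ y ∂volume.restrict (interactionDomain β ε Ω), u y = 0 := by
  have hint : IntegrableOn (fun x => u x ^ 2) (interactionDomain β ε Ω) :=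
    IntegrableOn.mono_set (Lp.memLp u).integrable_sq subset_union_right
  filter_upwards [(integral_eq_zero_iff_of_nonneg (fun x => sq_nonneg _) hint).1 hu] with y hy
  exact pow_eq_zero_iff two_ne_zero |>.1 hy

theorem exists_enorm_sq_le_of_dirichlet (hn : 1 ≤ n) (hΩ : IsOpen Ω)
    (hΩb : Bornology.IsBounded Ω) {R : ℝ} (hR : 0 < R) (hRε : ENNReal.ofReal R ≤ ε) :
    ∃ C : ℝ≥0, ∀ u : L2 β ε Ω, constraintFunctional .dirichlet β ε Ω u = 0 →
      ‖u‖ₑ ^ 2 ≤ C * nearEnergy volume (fullDomain β ε Ω) R u := by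
  obtain ⟨C, hC⟩ := poincareVanishingOn_of_chain (μ := volume) (isOpen_fullDomain hΩ)
    subset_union_left (hΩb.isCompact_closure.totallyBounded.subset subset_closure) hR
    fun p hp => exists_chain_interior_interactionDomain (β := β) hn hΩ hΩb hR hRε hp
  refine ⟨C, fun u hu => ?_⟩
  have hzero := ae_eq_zero_of_dirichlet hu
  have hvanish : ∫⁻ x in interactionDomain β ε Ω, ‖u x‖ₑ ^ 2 = 0 := by
    rw [← lintegral_zero]
    refine lintegral_congr_ae ?_
    filter_upwards [hzero] with y hy
    simp [hy]
  calc ‖u‖ₑ ^ 2 = ∫⁻ x in fullDomain β ε Ω, ‖u x‖ₑ ^ 2 := enorm_sq_eq_lintegral u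
    _ ≤ (∫⁻ x in Ω, ‖u x‖ₑ ^ 2) + ∫⁻ x in interactionDomain β ε Ω, ‖u x‖ₑ ^ 2 :=
      lintegral_union_le _ _ _
    _ = ∫⁻ x in Ω, ‖u x‖ₑ ^ 2 := by rw [hvanish, add_zero]
    _ ≤ C * nearEnergy volume (fullDomain β ε Ω) R u :=
      hC u (Lp.stronglyMeasurable u).measurable hzero

theorem exists_enorm_sq_le_of_neumann (hΩ : IsOpen Ω) (hΩb : Bornology.IsBounded Ω)
    (hε : 0 < ε) (hε_top : ε ≠ ∞) (hchain : IsChainConnected ε (fullDomain β ε Ω)) :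
    ∃ C : ℝ≥0, ∀ u : L2 β ε Ω, constraintFunctional .neumann β ε Ω u = 0 →
      ‖u‖ₑ ^ 2 ≤ C * nearEnergy volume (fullDomain β ε Ω) ε.toReal u := by
  set S := fullDomain β ε Ω
  have hstep : (fun p q => p ∈ S ∧ q ∈ S ∧ edist p q < ε) ≤ ChainStep S ε.toReal := fun p q h =>
    ⟨h.1, h.2.1, by
      rw [dist_edist, ENNReal.toReal_lt_toReal (edist_ne_top p q) hε_top]
      exact h.2.2⟩
  have hS_bdd : Bornology.IsBounded S := isBounded_fullDomain hΩb hε_top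
  obtain ⟨C, hC⟩ := exists_lintegral_enorm_sq_le_of_integral_eq_zero (μ := volume)
    (isOpen_fullDomain hΩ) (hS_bdd.isCompact_closure.totallyBounded.subset subset_closure)
    (ENNReal.toReal_pos hε.ne' hε_top)
    fun x hx y hy => Relation.ReflTransGen.mono hstep x y (hchain x hx y hy)
  refine ⟨C, fun u hu => ?_⟩
  rw [enorm_sq_eq_lintegral]
  exact hC u (Lp.stronglyMeasurable u).measurable (Lp.memLp u) (pow_eq_zero_iff two_ne_zero |>.1 hu)

theorem exists_enorm_sq_le_nearEnergy (hn : 1 ≤ n) (hΩ : IsOpen Ω) (hΩb : Bornology.IsBounded Ω)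
    (hε : 0 < ε) (c : VolumeConstraint)
    (hc : c = .neumann → ε ≠ ∞ ∧ IsChainConnected ε (fullDomain β ε Ω)) :
    ∃ R : ℝ, ENNReal.ofReal R ≤ ε ∧ ∃ C : ℝ≥0, ∀ u : L2 β ε Ω,
      constraintFunctional c β ε Ω u = 0 →
        ‖u‖ₑ ^ 2 ≤ C * nearEnergy volume (fullDomain β ε Ω) R u := by
  cases c with
  | dirichlet =>
    obtain ⟨R, hR, hRε⟩ := ENNReal.lt_iff_exists_nnreal_btwn.1 hε
    have hRε' : ENNReal.ofReal R ≤ ε := by rw [ENNReal.ofReal_coe_nnreal]; exact hRε.le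
    exact ⟨R, hRε', exists_enorm_sq_le_of_dirichlet hn hΩ hΩb (by simpa using hR) hRε'⟩
  | neumann =>
    obtain ⟨hε_top, hchain⟩ := hc rfl
    exact ⟨ε.toReal, ENNReal.ofReal_toReal_le,
      exists_enorm_sq_le_of_neumann hΩ hΩb hε hε_top hchain⟩

end Domain

section Kernel

variable {n : ℕ} {β : Sp n → ℝ} {ε : ℝ≥0∞} {S : Set (Sp n)} {aLow aUp σ : ℝ}
  {A : Sp n → Sp n → Matrix (Fin n) (Fin n) ℝ} {u : Sp n → ℝ} {x y : Sp n} {R : ℝ}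

/-- Uniform ellipticity, with constants `aLow` and `aUp`, of a diffusion tensor at a fixed time,
over the pairs of points of `S` within the horizon `ε`. -/
structure IsElliptic (ε : ℝ≥0∞) (S : Set (Sp n)) (aLow aUp : ℝ)
    (A : Sp n → Sp n → Matrix (Fin n) (Fin n) ℝ) : Prop where
  aLow_pos : 0 < aLow
  lower : ∀ x ∈ S, ∀ y ∈ S, edist y x ≤ ε → ∀ ξ : Sp n,
    aLow * ‖ξ‖ ^ 2 ≤ ∑ i, ∑ j, A x y i j * ξ i * ξ j
  upper : ∀ x ∈ S, ∀ y ∈ S, edist y x ≤ ε → ∀ ξ : Sp n,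
    ∑ i, ∑ j, A x y i j * ξ i * ξ j ≤ aUp * ‖ξ‖ ^ 2

theorem IsDiffusionTensor.isElliptic {T t : ℝ} {a : ℝ → Sp n → Sp n → Matrix (Fin n) (Fin n) ℝ}
    (ha : IsDiffusionTensor T ε S aLow aUp a) (ht : t ∈ Icc 0 T) :
    IsElliptic ε S aLow aUp (a t) :=
  ⟨ha.aLow_pos, ha.lower t ht, ha.upper t ht⟩

/-- The density `D*(u)(x,y) · (A(x,y) D*(u)(x,y))` whose double integral is `2 |||u|||²`. -/
def energyDensity (β : Sp n → ℝ) (ε : ℝ≥0∞) (A : Sp n → Sp n → Matrix (Fin n) (Fin n) ℝ)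
    (u : Sp n → ℝ) (x y : Sp n) : ℝ :=
  (Dstar β ε u x y).ofLp ⬝ᵥ (A x y *ᵥ (Dstar β ε u x y).ofLp)

/-- The Gagliardo density, whose double integral is the square of the Sobolev seminorm. -/
def sobolevDensity (β : Sp n → ℝ) (u : Sp n → ℝ) (x y : Sp n) : ℝ :=
  (u y - u x) ^ 2 / ‖y - x‖ ^ ((n : ℝ) + 2 * β x)

theorem energyDensity_eq_sum :
    energyDensity β ε A u x y =
      ∑ i, ∑ j, A x y i j * Dstar β ε u x y i * Dstar β ε u x y j := by
  simp only [energyDensity, dotProduct, Matrix.mulVec, Finset.mul_sum]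
  exact Finset.sum_congr rfl fun i _ => Finset.sum_congr rfl fun j _ => by ring

theorem norm_Dstar_sq (h : edist y x ≤ ε) : ‖Dstar β ε u x y‖ ^ 2 = sobolevDensity β u x y := by
  rcases eq_or_ne y x with rfl | hne
  · simp [Dstar, sobolevDensity]
  have hr : 0 < ‖y - x‖ := norm_pos_iff.2 (sub_ne_zero.2 hne)
  have hsucc : ‖y - x‖ ^ ((n : ℝ) / 2 + β x + 1) = ‖y - x‖ ^ ((n : ℝ) / 2 + β x) * ‖y - x‖ := by
    rw [Real.rpow_add hr, Real.rpow_one]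
  have hsq : ‖y - x‖ ^ ((n : ℝ) + 2 * β x) = (‖y - x‖ ^ ((n : ℝ) / 2 + β x)) ^ 2 := by
    rw [← Real.rpow_mul_natCast hr.le]
    congr 1
    push_cast
    ring
  have hpos : 0 < ‖y - x‖ ^ ((n : ℝ) / 2 + β x) := Real.rpow_pos_of_pos hr _
  rw [Dstar, sobolevDensity, alpha, if_pos h, norm_smul, norm_smul, norm_neg, hsq, hsucc, norm_inv,
    Real.norm_eq_abs, norm_mul, norm_norm, Real.norm_of_nonneg hpos.le, mul_pow, sq_abs]
  field_simp

theorem IsElliptic.sobolevDensity_le (hA : IsElliptic ε S aLow aUp A) (hx : x ∈ S) (hy : y ∈ S)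
    (h : edist y x ≤ ε) : sobolevDensity β u x y ≤ aLow⁻¹ * energyDensity β ε A u x y := by
  rw [← norm_Dstar_sq h, energyDensity_eq_sum, le_inv_mul_iff₀ hA.aLow_pos]
  exact hA.lower x hx y hy h _

theorem IsElliptic.energyDensity_le (hA : IsElliptic ε S aLow aUp A) (hx : x ∈ S) (hy : y ∈ S) :
    energyDensity β ε A u x y ≤ |aUp| * sobolevDensity β u x y := by
  by_cases h : edist y x ≤ ε
  · rw [← norm_Dstar_sq h, energyDensity_eq_sum]
    refine (hA.upper x hx y hy h _).trans ?_
    gcongr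
    exact le_abs_self _
  · simp only [energyDensity, Dstar, alpha, if_neg h, smul_zero, WithLp.ofLp_zero,
      zero_dotProduct, sobolevDensity]
    positivity

theorem sq_le_mul_sobolevDensity (h : ‖y - x‖ ≤ R) (hβ : (n : ℝ) + 2 * β x ∈ Icc 0 σ) :
    (u y - u x) ^ 2 ≤ max 1 R ^ σ * sobolevDensity β u x y := by
  rcases eq_or_ne y x with rfl | hne
  · simp [sobolevDensity]
  have hr : 0 < ‖y - x‖ := norm_pos_iff.2 (sub_ne_zero.2 hne)
  have hpow : ‖y - x‖ ^ ((n : ℝ) + 2 * β x) ≤ max 1 R ^ σ :=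
    (Real.rpow_le_rpow hr.le (h.trans (le_max_right _ _)) hβ.1).trans
      (Real.rpow_le_rpow_of_exponent_le (le_max_left _ _) hβ.2)
  rw [sobolevDensity, mul_div_assoc', le_div_iff₀ (Real.rpow_pos_of_pos hr _), mul_comm]
  gcongr

theorem sobolevDensity_le_mul_sq (hR : 0 < R) (h : R ≤ ‖y - x‖)
    (hβ : (n : ℝ) + 2 * β x ∈ Icc 0 σ) :
    sobolevDensity β u x y ≤ (min 1 R ^ σ)⁻¹ * (u y - u x) ^ 2 := by
  have hmin : 0 < min 1 R := lt_min one_pos hR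
  have hpow : min 1 R ^ σ ≤ ‖y - x‖ ^ ((n : ℝ) + 2 * β x) :=
    (Real.rpow_le_rpow_of_exponent_ge hmin (min_le_left _ _) hβ.2).trans
      (Real.rpow_le_rpow hmin.le ((min_le_right _ _).trans h) hβ.1)
  have := Real.rpow_pos_of_pos hmin σ
  rw [sobolevDensity, div_eq_inv_mul]
  gcongr

end Kernel

section Norms

theorem setLIntegral_setLIntegral_ofReal_le {X : Type*} [MeasurableSpace X] {μ : Measure X}
    {S : Set X} {V : X → Set X} (hS : MeasurableSet S) (hV : ∀ x ∈ S, MeasurableSet (V x))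
    (hVS : ∀ x ∈ S, V x ⊆ S) {f g : X → X → ℝ} {c : ℝ} (hc : 0 ≤ c)
    (h : ∀ x ∈ S, ∀ y ∈ V x, f x y ≤ c * g x y) :
    ∫⁻ x in S, ∫⁻ y in V x, ENNReal.ofReal (f x y) ∂μ ∂μ ≤
      ENNReal.ofReal c * ∫⁻ x in S, ∫⁻ y in S, ENNReal.ofReal (g x y) ∂μ ∂μ := by
  rw [← lintegral_const_mul' _ _ ENNReal.ofReal_ne_top]
  refine setLIntegral_mono' hS fun x hx => ?_
  rw [← lintegral_const_mul' _ _ ENNReal.ofReal_ne_top]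
  refine (setLIntegral_mono' (hV x hx) fun y hy => ?_).trans (lintegral_mono_set (hVS x hx))
  rw [← ENNReal.ofReal_mul hc]
  exact ENNReal.ofReal_le_ofReal (h x hx y hy)

theorem edist_sq_eq_ofReal (a b : ℝ) : edist a b ^ 2 = ENNReal.ofReal ((b - a) ^ 2) := by
  rw [edist_comm, edist_dist, ← ENNReal.ofReal_pow dist_nonneg, Real.dist_eq, sq_abs]

theorem le_sqrt_mul_of_sq_le {a b : ℝ≥0∞} {C : ℝ≥0} (h : a ^ 2 ≤ C * b ^ 2) :
    a ≤ NNReal.sqrt C * b := by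
  rw [← ENNReal.pow_le_pow_left_iff two_ne_zero, mul_pow, ← ENNReal.coe_pow, NNReal.sq_sqrt]
  exact h

variable {n : ℕ} {β : Sp n → ℝ} {ε : ℝ≥0∞} {Ω : Set (Sp n)} {aLow aUp σ : ℝ}
  {a : ℝ → Sp n → Sp n → Matrix (Fin n) (Fin n) ℝ} {t : ℝ}

theorem sobolevSeminorm_sq (u : L2 β ε Ω) :
    sobolevSeminorm β ε Ω u ^ 2 = ∫⁻ x in fullDomain β ε Ω, ∫⁻ y in fullDomain β ε Ω,
      ENNReal.ofReal (sobolevDensity β u x y) := by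
  rw [sobolevSeminorm, ← ENNReal.rpow_ofNat, ← ENNReal.rpow_mul,
    one_div_mul_cancel two_ne_zero, ENNReal.rpow_one]
  rfl

theorem two_mul_energyNorm_sq (u : L2 β ε Ω) :
    2 * energyNorm β ε Ω a t u ^ 2 = ∫⁻ x in fullDomain β ε Ω, ∫⁻ y in fullDomain β ε Ω,
      ENNReal.ofReal (energyDensity β ε (a t) u x y) := by
  rw [energyNorm, ← ENNReal.rpow_ofNat, ← ENNReal.rpow_mul,
    one_div_mul_cancel two_ne_zero, ENNReal.rpow_one, ← mul_assoc,
    ENNReal.mul_inv_cancel two_ne_zero ENNReal.ofNat_ne_top, one_mul]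
  rfl

theorem IsElliptic.energyNorm_le (hΩ : IsOpen Ω)
    (ha : IsElliptic ε (fullDomain β ε Ω) aLow aUp (a t)) (u : L2 β ε Ω) :
    energyNorm β ε Ω a t u ≤ NNReal.sqrt |aUp|.toNNReal * sobolevNorm β ε Ω u := by
  have hS := (isOpen_fullDomain (β := β) (ε := ε) hΩ).measurableSet
  have hsq : energyNorm β ε Ω a t u ^ 2 ≤ |aUp|.toNNReal * sobolevSeminorm β ε Ω u ^ 2 := by
    calc energyNorm β ε Ω a t u ^ 2
        ≤ 2 * energyNorm β ε Ω a t u ^ 2 := le_mul_of_one_le_left' one_le_two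
      _ ≤ |aUp|.toNNReal * sobolevSeminorm β ε Ω u ^ 2 := by
        rw [two_mul_energyNorm_sq, sobolevSeminorm_sq]
        exact setLIntegral_setLIntegral_ofReal_le hS (fun _ _ => hS) (fun _ _ => subset_rfl)
          (abs_nonneg _) fun x hx y hy => ha.energyDensity_le hx hy
  calc energyNorm β ε Ω a t u ≤ NNReal.sqrt |aUp|.toNNReal * sobolevSeminorm β ε Ω u :=
        le_sqrt_mul_of_sq_le hsq
    _ ≤ NNReal.sqrt |aUp|.toNNReal * sobolevNorm β ε Ω u := by
        gcongr
        exact le_add_self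

theorem IsElliptic.nearEnergy_le (hΩ : IsOpen Ω)
    (ha : IsElliptic ε (fullDomain β ε Ω) aLow aUp (a t))
    (hβ : ∀ x ∈ fullDomain β ε Ω, (n : ℝ) + 2 * β x ∈ Icc 0 σ) {R : ℝ}
    (hRε : ENNReal.ofReal R ≤ ε) (u : L2 β ε Ω) :
    nearEnergy volume (fullDomain β ε Ω) R u ≤
      (max 1 R ^ σ * aLow⁻¹).toNNReal * (2 * energyNorm β ε Ω a t u ^ 2) := by
  have hS := (isOpen_fullDomain (β := β) (ε := ε) hΩ).measurableSet
  have hmax : 0 ≤ max 1 R ^ σ := by positivity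
  rw [two_mul_energyNorm_sq]
  simp_rw [nearEnergy, edist_sq_eq_ofReal]
  refine setLIntegral_setLIntegral_ofReal_le hS (fun x _ => hS.inter measurableSet_ball)
    (fun _ _ => inter_subset_left) (mul_nonneg hmax (inv_nonneg.2 ha.aLow_pos.le))
    fun x hx y ⟨hy, hxy⟩ => ?_
  rw [Metric.mem_ball] at hxy
  have hxy_ε : edist y x ≤ ε := by
    rw [edist_dist]
    exact (ENNReal.ofReal_le_ofReal hxy.le).trans hRε
  calc (u y - u x) ^ 2 ≤ max 1 R ^ σ * sobolevDensity β u x y :=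
        sq_le_mul_sobolevDensity (dist_eq_norm y x ▸ hxy.le) (hβ x hx)
    _ ≤ max 1 R ^ σ * (aLow⁻¹ * energyDensity β ε (a t) u x y) := by
        gcongr
        exact ha.sobolevDensity_le hx hy hxy_ε
    _ = _ := (mul_assoc _ _ _).symm

theorem IsElliptic.sobolevSeminorm_sq_le_of_top (hΩ : IsOpen Ω)
    (ha : IsElliptic ∞ (fullDomain β ∞ Ω) aLow aUp (a t)) (u : L2 β ∞ Ω) :
    sobolevSeminorm β ∞ Ω u ^ 2 ≤ aLow⁻¹.toNNReal * (2 * energyNorm β ∞ Ω a t u ^ 2) := by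
  have hS := (isOpen_fullDomain (β := β) (ε := ∞) hΩ).measurableSet
  rw [two_mul_energyNorm_sq, sobolevSeminorm_sq]
  exact setLIntegral_setLIntegral_ofReal_le hS (fun _ _ => hS) (fun _ _ => subset_rfl)
    (inv_nonneg.2 ha.aLow_pos.le) fun x hx y hy => ha.sobolevDensity_le hx hy le_top

theorem IsElliptic.ofReal_sobolevDensity_le {S : Set (Sp n)}
    {A : Sp n → Sp n → Matrix (Fin n) (Fin n) ℝ} (hA : IsElliptic ε S aLow aUp A) (hε : 0 < ε)
    (hε_top : ε ≠ ∞) (u : Sp n → ℝ) {x y : Sp n} (hx : x ∈ S) (hy : y ∈ S)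
    (hβ : (n : ℝ) + 2 * β x ∈ Icc 0 σ) :
    ENNReal.ofReal (sobolevDensity β u x y) ≤
      aLow⁻¹.toNNReal * ENNReal.ofReal (energyDensity β ε A u x y) +
        ((min 1 ε.toReal ^ σ)⁻¹).toNNReal * edist (u x) (u y) ^ 2 := by
  rcases le_or_gt (edist y x) ε with hnear | hfar
  · refine le_add_right ?_
    rw [← ENNReal.ofReal, ← ENNReal.ofReal_mul (inv_nonneg.2 hA.aLow_pos.le)]
    exact ENNReal.ofReal_le_ofReal (hA.sobolevDensity_le hx hy hnear)
  · have hR := ENNReal.toReal_pos hε.ne' hε_top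
    have hfar' : ε.toReal ≤ ‖y - x‖ := by
      rw [← dist_eq_norm, dist_edist]
      exact ENNReal.toReal_mono (edist_ne_top _ _) hfar.le
    refine le_add_left ?_
    rw [edist_sq_eq_ofReal, ← ENNReal.ofReal, ← ENNReal.ofReal_mul (by positivity)]
    exact ENNReal.ofReal_le_ofReal (sobolevDensity_le_mul_sq hR hfar' hβ)

theorem IsElliptic.sobolevSeminorm_sq_le_of_ne_top (hΩ : IsOpen Ω)
    (hΩb : Bornology.IsBounded Ω) (hε : 0 < ε) (hε_top : ε ≠ ∞)
    (ha : IsElliptic ε (fullDomain β ε Ω) aLow aUp (a t))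
    (hβ : ∀ x ∈ fullDomain β ε Ω, (n : ℝ) + 2 * β x ∈ Icc 0 σ) (u : L2 β ε Ω) :
    sobolevSeminorm β ε Ω u ^ 2 ≤ aLow⁻¹.toNNReal * (2 * energyNorm β ε Ω a t u ^ 2) +
      ((min 1 ε.toReal ^ σ)⁻¹).toNNReal * (4 * volume (fullDomain β ε Ω) * ‖u‖ₑ ^ 2) := by
  have hS := (isOpen_fullDomain (β := β) (ε := ε) hΩ).measurableSet
  have hu : Measurable u := (Lp.stronglyMeasurable u).measurable
  have hmeas := measurable_edist_sq hu
  calc sobolevSeminorm β ε Ω u ^ 2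
      ≤ ∫⁻ x in fullDomain β ε Ω, ∫⁻ y in fullDomain β ε Ω,
          (aLow⁻¹.toNNReal * ENNReal.ofReal (energyDensity β ε (a t) u x y) +
            ((min 1 ε.toReal ^ σ)⁻¹).toNNReal * edist (u x) (u y) ^ 2) := by
        rw [sobolevSeminorm_sq]
        exact setLIntegral_mono' hS fun x hx => setLIntegral_mono' hS fun y hy =>
          ha.ofReal_sobolevDensity_le hε hε_top u hx hy (hβ x hx)
    _ = aLow⁻¹.toNNReal * (2 * energyNorm β ε Ω a t u ^ 2) + ((min 1 ε.toReal ^ σ)⁻¹).toNNReal *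
          oscillation volume u (fullDomain β ε Ω) (fullDomain β ε Ω) := by
        rw [two_mul_energyNorm_sq, oscillation, ← lintegral_const_mul' _ _ ENNReal.coe_ne_top,
          ← lintegral_const_mul' _ _ ENNReal.coe_ne_top,
          ← lintegral_add_right _ (hmeas.lintegral_prod_right'.const_mul _)]
        refine lintegral_congr fun x => ?_
        rw [lintegral_add_right _ (by fun_prop), lintegral_const_mul' _ _ ENNReal.coe_ne_top,
          lintegral_const_mul' _ _ ENNReal.coe_ne_top]
    _ ≤ _ := by
        gcongr
        rw [enorm_sq_eq_lintegral]
        exact oscillation_self_le u (isBounded_fullDomain hΩb hε_top).measure_lt_top.ne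

theorem exists_sobolevSeminorm_sq_le (hΩ : IsOpen Ω) (hΩb : Bornology.IsBounded Ω) (hε : 0 < ε)
    (hβ : ∀ x ∈ fullDomain β ε Ω, (n : ℝ) + 2 * β x ∈ Icc 0 σ) (aLow : ℝ) :
    ∃ C : ℝ≥0, ∀ a t aUp, IsElliptic ε (fullDomain β ε Ω) aLow aUp (a t) → ∀ u : L2 β ε Ω,
      sobolevSeminorm β ε Ω u ^ 2 ≤ C * (2 * energyNorm β ε Ω a t u ^ 2 + ‖u‖ₑ ^ 2) := by
  rcases eq_or_ne ε ∞ with rfl | hε_top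
  · refine ⟨aLow⁻¹.toNNReal, fun a t aUp ha u => ?_⟩
    refine (ha.sobolevSeminorm_sq_le_of_top hΩ u).trans ?_
    gcongr
    exact le_self_add
  · set M := ((min 1 ε.toReal ^ σ)⁻¹).toNNReal
    have hvol : volume (fullDomain β ε Ω) ≠ ∞ :=
      (isBounded_fullDomain hΩb hε_top).measure_lt_top.ne
    refine ⟨aLow⁻¹.toNNReal + M * (4 * (volume (fullDomain β ε Ω)).toNNReal),
      fun a t aUp ha u => (ha.sobolevSeminorm_sq_le_of_ne_top hΩ hΩb hε hε_top hβ u).trans ?_⟩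
    push_cast [ENNReal.coe_toNNReal hvol]
    rw [mul_add, ← mul_assoc (M : ℝ≥0∞)]
    gcongr
    exacts [le_self_add, le_add_self]

theorem exists_sobolevNorm_le_energyNorm (hn : 1 ≤ n) (hΩ : IsOpen Ω)
    (hΩb : Bornology.IsBounded Ω) (hε : 0 < ε)
    (hβ : ∀ x ∈ fullDomain β ε Ω, (n : ℝ) + 2 * β x ∈ Icc 0 σ) (aLow : ℝ) (c : VolumeConstraint)
    (hc : c = .neumann → ε ≠ ∞ ∧ IsChainConnected ε (fullDomain β ε Ω)) :
    ∃ C : ℝ≥0, ∀ a t aUp, IsElliptic ε (fullDomain β ε Ω) aLow aUp (a t) → ∀ u : L2 β ε Ω,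
      constraintFunctional c β ε Ω u = 0 →
        sobolevNorm β ε Ω u ≤ C * energyNorm β ε Ω a t u := by
  obtain ⟨R, hRε, P, hP⟩ := exists_enorm_sq_le_nearEnergy hn hΩ hΩb hε c hc
  obtain ⟨K, hK⟩ := exists_sobolevSeminorm_sq_le hΩ hΩb hε hβ aLow
  set L : ℝ≥0 := P * ((max 1 R ^ σ * aLow⁻¹).toNNReal * 2)
  refine ⟨NNReal.sqrt L + NNReal.sqrt (K * (2 + L)), fun a t aUp ha u hu => ?_⟩
  have hnorm : ‖u‖ₑ ^ 2 ≤ L * energyNorm β ε Ω a t u ^ 2 := by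
    calc ‖u‖ₑ ^ 2 ≤ P * nearEnergy volume (fullDomain β ε Ω) R u := hP u hu
      _ ≤ P * ((max 1 R ^ σ * aLow⁻¹).toNNReal * (2 * energyNorm β ε Ω a t u ^ 2)) := by
        gcongr
        exact ha.nearEnergy_le hΩ hβ hRε u
      _ = L * energyNorm β ε Ω a t u ^ 2 := by
        push_cast [L]
        ring
  have hseminorm : sobolevSeminorm β ε Ω u ^ 2 ≤
      (K * (2 + L) : ℝ≥0) * energyNorm β ε Ω a t u ^ 2 := by
    calc sobolevSeminorm β ε Ω u ^ 2
        ≤ K * (2 * energyNorm β ε Ω a t u ^ 2 + ‖u‖ₑ ^ 2) := hK a t aUp ha u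
      _ ≤ K * (2 * energyNorm β ε Ω a t u ^ 2 + L * energyNorm β ε Ω a t u ^ 2) := by gcongr
      _ = (K * (2 + L) : ℝ≥0) * energyNorm β ε Ω a t u ^ 2 := by
        push_cast
        ring
  rw [sobolevNorm, ENNReal.coe_add, add_mul]
  exact add_le_add (le_sqrt_mul_of_sq_le hnorm) (le_sqrt_mul_of_sq_le hseminorm)

end Norms

end NonlocalDiffusion

end

open NonlocalDiffusion in
theorem theorem2p1_general {n : ℕ} (hn : 1 ≤ n) {Ω : Set (Sp n)} (hΩ : IsOpen Ω)
    (hΩb : Bornology.IsBounded Ω) {ε : ℝ≥0∞} (hε : 0 < ε) {β : Sp n → ℝ} {σ : ℝ}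
    (hβ : ∀ x ∈ fullDomain β ε Ω, (n : ℝ) + 2 * β x ∈ Icc 0 σ) (aLow aUp : ℝ)
    (c : VolumeConstraint)
    (hc : c = .neumann → ε ≠ ∞ ∧ IsChainConnected ε (fullDomain β ε Ω)) :
    ∃ C : ℝ≥0, 0 < C ∧ ∀ a t, IsElliptic ε (fullDomain β ε Ω) aLow aUp (a t) →
      (∀ u ∈ constrainedEnergySpace c β ε Ω a t,
        (C : ℝ≥0∞)⁻¹ * sobolevNorm β ε Ω u ≤ energyNorm β ε Ω a t u ∧
          energyNorm β ε Ω a t u ≤ C * sobolevNorm β ε Ω u) ∧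
      constrainedSobolevSpace c β ε Ω = constrainedEnergySpace c β ε Ω a t := by
  obtain ⟨K, hK⟩ := exists_sobolevNorm_le_energyNorm hn hΩ hΩb hε hβ aLow c hc
  set L : ℝ≥0 := NNReal.sqrt |aUp|.toNNReal
  refine ⟨K + L + 1, by positivity, fun a t ha => ⟨fun u hu => ⟨?_, ?_⟩, ?_⟩⟩
  · rw [ENNReal.inv_mul_le_iff (by simp) ENNReal.coe_ne_top]
    refine (hK a t aUp ha u hu.2).trans ?_
    gcongr
    exact le_add_right le_self_add
  · refine (ha.energyNorm_le hΩ u).trans ?_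
    gcongr
    exact le_add_right le_add_self
  · ext u
    refine and_congr_left fun hu => ⟨fun h => ?_, fun h => ?_⟩
    · exact (ha.energyNorm_le hΩ u).trans_lt (ENNReal.mul_lt_top ENNReal.coe_lt_top h)
    · exact (hK a t aUp ha u hu).trans_lt (ENNReal.mul_lt_top ENNReal.coe_lt_top h)

theorem theorem2p1 {n : ℕ} (hn : 1 ≤ n)
    (Ω : Set (NonlocalDiffusion.Sp n)) (hΩ : IsOpen Ω) (hΩb : Bornology.IsBounded Ω)
    (ε : ℝ≥0∞) (hε : 0 < ε)
    (β : NonlocalDiffusion.Sp n → ℝ) (βLow βUp : ℝ) (hβLow : 0 < βLow) (hβUp : βUp < 1)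
    (hβc : ContinuousOn β (NonlocalDiffusion.fullDomain β ε Ω))
    (hβ : ∀ x ∈ NonlocalDiffusion.fullDomain β ε Ω, βLow ≤ β x ∧ β x ≤ βUp)
    (T : ℝ) (hT : 0 < T) (aLow aUp : ℝ)
    (a : ℝ → NonlocalDiffusion.Sp n → NonlocalDiffusion.Sp n → Matrix (Fin n) (Fin n) ℝ)
    (ha : NonlocalDiffusion.IsDiffusionTensor T ε (NonlocalDiffusion.fullDomain β ε Ω) aLow aUp a)
    (c : NonlocalDiffusion.VolumeConstraint)
    (hc : c = NonlocalDiffusion.VolumeConstraint.neumann →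
      ε ≠ ∞ ∧ NonlocalDiffusion.IsChainConnected ε (NonlocalDiffusion.fullDomain β ε Ω)) :
    (∃ C : ℝ≥0, 0 < C ∧ ∀ t ∈ Icc (0 : ℝ) T,
      ∀ u ∈ NonlocalDiffusion.constrainedEnergySpace c β ε Ω a t,
        (C : ℝ≥0∞)⁻¹ * NonlocalDiffusion.sobolevNorm β ε Ω u
            ≤ NonlocalDiffusion.energyNorm β ε Ω a t u ∧
          NonlocalDiffusion.energyNorm β ε Ω a t u
            ≤ (C : ℝ≥0∞) * NonlocalDiffusion.sobolevNorm β ε Ω u) ∧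
      ∀ t ∈ Icc (0 : ℝ) T,
        NonlocalDiffusion.constrainedSobolevSpace c β ε Ω
          = NonlocalDiffusion.constrainedEnergySpace c β ε Ω a t := by
  have hβ' : ∀ x ∈ NonlocalDiffusion.fullDomain β ε Ω, (n : ℝ) + 2 * β x ∈ Icc 0 ((n : ℝ) + 2) :=
    fun x hx => ⟨by linarith [hβ x hx, n.cast_nonneg (α := ℝ)], by linarith [hβ x hx]⟩
  obtain ⟨C, hC, hmain⟩ := theorem2p1_general hn hΩ hΩb hε hβ' aLow aUp c hc
  exact ⟨⟨C, hC, fun t ht => (hmain a t (ha.isElliptic ht)).1⟩,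
    fun t ht => (hmain a t (ha.isElliptic ht)).2⟩
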